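/- Let $P=(X,\leqslant)$ be a finite poset of width $2$ (that is, a largest antichain of $P$ has exactly $2$ elements). Let $\bar G(P)$ be its incomparability graph, i.e. the graph on $X$ in which two elements are adjacent if and only if they are incomparable in $P$, and let $e(P)$ be the number of linear extensions of $P$. For a finite graph $G=(V,E)$ with $n=|V|$, let $\mathrm{STAB}(G)\subseteq\mathbb{R}^V$ be the convex hull of the characteristic vectors of the stable sets of $G$, and let $$H(G)=\min_{x\in \mathrm{STAB}(G),\ x>0}\ -\sum_{v\in V}\frac1n\log_2 x_v$$ be the entropy of $G$. Then $$|P|\cdot H(\bar G(P)) = 2\log_2 e(P)$$ if and only if the maximum degree of $\bar G(P)$ is $1$. Moreover, the maximum degree of $\bar G(P)$ is $1$ if and only if $P$ is an ordinal sum $A_1\oplus A_2\oplus\cdots\oplus A_k$ of antichains with $|A_i|\in\{1,2\}$ for every $i$ (that is, $X$ is partitioned into antichains $A_1,\dots,A_k$ of one or two elements such that every element of $A_i$ is smaller than every element of $A_j$ whenever $i<j$). -/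

import Mathlib

/-- The incomparability graph of a poset: two elements are adjacent iff neither is `≤` the other. -/
def incompGraph (P : Type*) [PartialOrder P] : SimpleGraph P where
  Adj a b := IncompRel (· ≤ ·) a b
  symm := ⟨fun _ _ h => ⟨h.2, h.1⟩⟩
  loopless := ⟨fun _ h => h.1 le_rfl⟩

open Classical in
/-- The width of a finite poset: the size of a largest antichain. -/
noncomputable def posetWidth (P : Type*) [PartialOrder P] [Fintype P] : ℕ :=
  (Finset.univ.filter fun s : Finset P => IsAntichain (· ≤ ·) (s : Set P)).sup Finset.card

/-- The number `e(P)` of linear extensions of a finite poset, a linear extension being an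
order-preserving bijection onto `{0, …, |P| - 1}`. -/
noncomputable def numLinearExtensions (P : Type*) [PartialOrder P] [Fintype P] : ℕ :=
  Nat.card {f : P ≃ Fin (Fintype.card P) // Monotone f}

/-- The stable set polytope `STAB(G)`: the convex hull of the characteristic vectors of the
stable sets of `G`. -/
def stabPolytope {V : Type*} (G : SimpleGraph V) : Set (V → ℝ) :=
  convexHull ℝ {x | ∃ S : Set V, G.IsIndepSet S ∧ x = S.indicator 1}

/-- The values of `-∑ v, (1 / n) log₂ (x v)` at the points `x > 0` of `STAB(G)`. -/
def entropyValues {V : Type*} [Fintype V] (G : SimpleGraph V) : Set ℝ :=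
  (fun x : V → ℝ => -∑ v, (1 / (Fintype.card V : ℝ)) * Real.logb 2 (x v)) ''
    {x | x ∈ stabPolytope G ∧ ∀ v, 0 < x v}

/-- The (Körner) entropy of a finite graph, for the uniform distribution on the vertices.
The infimum is a minimum, see `graphEntropy_isLeast`. -/
noncomputable def graphEntropy {V : Type*} [Fintype V] (G : SimpleGraph V) : ℝ :=
  sInf (entropyValues G)

/-- The infimum that defines the graph entropy is attained. -/
theorem graphEntropy_isLeast {V : Type*} [Fintype V] (G : SimpleGraph V) :
    IsLeast (entropyValues G) (graphEntropy G) := by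
  suffices h : ∃ a, IsLeast (entropyValues G) a by
    obtain ⟨a, ha⟩ := h
    rw [graphEntropy, ha.csInf_eq]
    exact ha
  have hfin : {x : V → ℝ | ∃ S : Set V, G.IsIndepSet S ∧ x = S.indicator 1}.Finite :=
    (Set.finite_range fun S : Set V => (S.indicator 1 : V → ℝ)).subset
      (by rintro x ⟨S, -, rfl⟩; exact ⟨S, rfl⟩)
  have hcomp : IsCompact (stabPolytope G) := hfin.isCompact_convexHull (𝕜 := ℝ)
  have hnonneg : ∀ x ∈ stabPolytope G, ∀ v, 0 ≤ x v := by
    have hsub : stabPolytope G ⊆ Set.Ici (0 : V → ℝ) := by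
      refine convexHull_min ?_ (convex_Ici 0)
      rintro x ⟨S, -, rfl⟩ v
      exact Set.indicator_nonneg (fun _ _ => zero_le_one) v
    exact fun x hx v => hsub hx v
  have hpos : ∃ x ∈ stabPolytope G, ∀ v, 0 < x v := by
    rcases isEmpty_or_nonempty V with hV | hV
    · exact ⟨(∅ : Set V).indicator 1, subset_convexHull ℝ _ ⟨∅, by simp, rfl⟩,
        fun v => hV.elim v⟩
    · have hn : (0 : ℝ) < Fintype.card V := by exact_mod_cast Fintype.card_pos
      refine ⟨∑ v : V, (1 / (Fintype.card V : ℝ)) • (({v} : Set V).indicator 1 : V → ℝ), ?_, ?_⟩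
      · refine (convex_convexHull ℝ _).sum_mem (fun _ _ => by positivity) ?_ fun v _ =>
          subset_convexHull ℝ _ ⟨{v}, by simp, rfl⟩
        simp [hn.ne']
      · intro w
        rw [Finset.sum_apply]
        refine lt_of_lt_of_le (b := (1 / (Fintype.card V : ℝ))) (by positivity) ?_
        refine le_trans (le_of_eq ?_) (Finset.single_le_sum (fun v _ => ?_) (Finset.mem_univ w))
        · simp
        · exact mul_nonneg (by positivity) (Set.indicator_nonneg (fun _ _ => zero_le_one) w)
  obtain ⟨z, hz, hz0⟩ := hpos
  obtain ⟨x, hx, hmax⟩ := hcomp.exists_isMaxOn ⟨z, hz⟩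
    (f := fun x : V → ℝ => ∏ v, x v) (by fun_prop)
  have hprod : 0 < ∏ v, x v :=
    lt_of_lt_of_le (Finset.prod_pos fun v _ => hz0 v) (hmax hz)
  have hx0 : ∀ v, 0 < x v := fun v =>
    lt_of_le_of_ne (hnonneg x hx v) fun h =>
      hprod.ne' (Finset.prod_eq_zero (Finset.mem_univ v) h.symm)
  refine ⟨_, ⟨x, ⟨hx, hx0⟩, rfl⟩, ?_⟩
  rintro _ ⟨y, ⟨hy, hy0⟩, rfl⟩
  simp only [← Finset.mul_sum]
  rw [← Real.logb_prod _ _ (fun v _ => (hx0 v).ne'), ← Real.logb_prod _ _ (fun v _ => (hy0 v).ne')]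
  have h1 : ∏ v, y v ≤ ∏ v, x v := hmax hy
  have h2 := Real.logb_le_logb_of_le (b := 2) (by norm_num)
    (Finset.prod_pos fun v _ => hy0 v) h1
  exact neg_le_neg (mul_le_mul_of_nonneg_left h2 (by positivity))

/-- `P` is an ordinal sum `A₁ ⊕ ⋯ ⊕ A_k` of antichains with one or two elements: the `Aᵢ` partition
`P`, and every element of `Aᵢ` is below every element of `Aⱼ` when `i < j`. -/
def IsOrdinalSumOfSmallAntichains (P : Type*) [PartialOrder P] : Prop :=
  ∃ (k : ℕ) (A : Fin k → Finset P),
    (∀ i, IsAntichain (· ≤ ·) (A i : Set P)) ∧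
    (∀ i, (A i).card = 1 ∨ (A i).card = 2) ∧
    (∀ x : P, ∃! i, x ∈ A i) ∧
    (∀ i j, i < j → ∀ x ∈ A i, ∀ y ∈ A j, x < y)

/-! Stable sets of the incomparability graph are chains, and `|P| * H` is the minimum of `-log₂ ∏
x_v` over positive `x` in the convex hull of their indicators.

Upper bound: `exists_chainHull_prod` builds, by induction on a subposet `S`, a point of the hull
with `e(S)² ∏ x_v ≥ 1`. A least element joins every chain and gets coordinate `1`. Otherwise there
are two minimal elements `a`, `b`, and `e(S) ≥ e(S \ {a}) + e(S \ {b})`. Width two lets each chain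
of `S \ {a}` or `S \ {b}` be extended so that it contains exactly one of `a`, `b`. A suitable
average of the two resulting points works: `exists_weight` controls the coordinates at `a` and `b`,
the weighted AM-GM inequality the others.

Strictness: the bound can be tight at such a step only if `a` and `b` are incomparable with nothing
but each other. An element incomparable with two others therefore survives their removal, until some
step is strict. So equality forces maximum degree `1`.

Conversely, if the maximum degree is `1`, each edge has `x_u x_v ≤ 1/4`, so `|P| * H ≥ 2|E|`, while
`e(P) ≤ 2 ^ |E|` because a linear extension is determined by how it orders the incomparable pairs.
-/

/-! ### Numerical inequalities for the averaging step. -/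

/-- For `p + q = 1`, the coordinates `1 - s` and `t` have an average `y` such that `y * (1 - y)` is at
least the corresponding average of `s * p ^ 2` and `t * q ^ 2`; the inequality is strict unless
`s = t = 1`. -/
theorem exists_weight {p q s t : ℝ} (hp : 0 < p) (hq : 0 < q) (hpq : p + q = 1)
    (hs0 : 0 < s) (hs : s ≤ 1) (ht0 : 0 < t) (ht : t ≤ 1) :
    ∃ w y : ℝ, 0 ≤ w ∧ w ≤ 1 ∧ y = w * (1 - s) + (1 - w) * t ∧
      w * (s * p ^ 2) + (1 - w) * (t * q ^ 2) ≤ y * (1 - y) ∧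
      (w * (s * p ^ 2) + (1 - w) * (t * q ^ 2) < y * (1 - y) ∨
        (s = 1 ∧ t = 1 ∧ 0 < w ∧ w < 1)) := by
  -- When `s` or `t` is far from `1`, an endpoint `w = 0` or `w = 1` already gives a strict
  -- inequality.
  by_cases h1 : q ^ 2 < 1 - t
  · have h : 0 * (s * p ^ 2) + (1 - 0) * (t * q ^ 2) < t * (1 - t) := by nlinarith
    exact ⟨0, t, le_rfl, zero_le_one, by ring, h.le, Or.inl h⟩
  by_cases h2 : p ^ 2 < 1 - s
  · have h : 1 * (s * p ^ 2) + (1 - 1) * (t * q ^ 2) < (1 - s) * (1 - (1 - s)) := by nlinarith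
    exact ⟨1, 1 - s, zero_le_one, le_rfl, by ring, h.le, Or.inl h⟩
  push Not at h1 h2
  obtain ⟨σ, rfl⟩ : ∃ σ, s = 1 - σ := ⟨1 - s, by ring⟩
  obtain ⟨τ, rfl⟩ : ∃ τ, t = 1 - τ := ⟨1 - t, by ring⟩
  obtain rfl : q = 1 - p := by linarith
  have hσ : σ ≤ p ^ 2 := by linarith
  have hτ : τ ≤ (1 - p) ^ 2 := by linarith
  have hσ0 : 0 ≤ σ := by linarith
  have hτ0 : 0 ≤ τ := by linarith
  have hu : 0 < (1 - p) - τ := by nlinarith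
  have hv : 0 < p - σ := by nlinarith
  have hd : 0 < 1 - σ - τ := by linarith
  -- This is nonnegativity of the numerator in `hid`; it uses `σ ≤ p²`, `τ ≤ q²` and `p² + q² ≤ (p +
  -- q)² = 1`.
  have key : σ * τ * (p ^ 2 + (1 - p) ^ 2) ≤ τ * p ^ 3 + σ * (1 - p) ^ 3 := by
    have e1 : τ * p * σ ≤ τ * p * p ^ 2 := by gcongr
    have e2 : σ * (1 - p) * τ ≤ σ * (1 - p) * (1 - p) ^ 2 := by gcongr
    have e3 : 0 ≤ σ * τ * (p * (1 - p)) := by positivity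
    nlinarith
  have key' : 0 < σ ∨ 0 < τ → σ * τ * (p ^ 2 + (1 - p) ^ 2) < τ * p ^ 3 + σ * (1 - p) ^ 3 := by
    intro h
    rcases hσ0.eq_or_lt with h0 | h0
    · have : 0 < τ := h.resolve_left (by simp [← h0])
      rw [← h0]
      have : 0 < τ * p ^ 3 := by positivity
      linarith
    rcases hτ0.eq_or_lt with h0' | h0'
    · rw [← h0']
      have : 0 < σ * (1 - p) ^ 3 := by positivity
      linarith
    have e1 : τ * p * σ ≤ τ * p * p ^ 2 := by gcongr
    have e2 : σ * (1 - p) * τ ≤ σ * (1 - p) * (1 - p) ^ 2 := by gcongr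
    have e3 : 0 < σ * τ * (p * (1 - p)) := by positivity
    nlinarith
  -- The weight `(q - τ) / (1 - σ - τ)` is the solution of `y = p`.
  have hid : p * (1 - p) - (((1 - p) - τ) / (1 - σ - τ) * ((1 - σ) * p ^ 2)
      + (1 - ((1 - p) - τ) / (1 - σ - τ)) * ((1 - τ) * (1 - p) ^ 2))
      = (τ * p ^ 3 + σ * (1 - p) ^ 3 - σ * τ * (p ^ 2 + (1 - p) ^ 2)) / (1 - σ - τ) := by
    field_simp
    ring
  have hw1 : ((1 - p) - τ) / (1 - σ - τ) < 1 := by rw [div_lt_one hd]; linarith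
  have hw0 : 0 < ((1 - p) - τ) / (1 - σ - τ) := div_pos hu hd
  refine ⟨((1 - p) - τ) / (1 - σ - τ), p, hw0.le, hw1.le, ?_, ?_, ?_⟩
  · field_simp
    ring
  · have := div_nonneg (sub_nonneg.2 key) hd.le
    linarith
  · by_cases h : 0 < σ ∨ 0 < τ
    · have := div_pos (sub_pos.2 (key' h)) hd
      exact Or.inl (by linarith)
    · push Not at h
      exact Or.inr ⟨by linarith, by linarith, hw0, hw1⟩

/-- Weighted arithmetic-geometric mean step: averaging two points keeps the bound
`1 ≤ N ^ 2 * ∏ x`. -/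
theorem one_le_sq_mul_prod_average {ι : Type*} (R : Finset ι) {z₁ z₂ : ι → ℝ}
    {p q s t w y N : ℝ} (hN : 0 < N) (hz₁ : ∀ i ∈ R, 0 < z₁ i) (hz₂ : ∀ i ∈ R, 0 < z₂ i)
    (hp : 0 < p) (hq : 0 < q) (hs : 0 < s) (ht : 0 < t) (hw0 : 0 ≤ w) (hw1 : w ≤ 1)
    (h₁ : 1 ≤ (N * p) ^ 2 * (s * ∏ i ∈ R, z₁ i)) (h₂ : 1 ≤ (N * q) ^ 2 * (t * ∏ i ∈ R, z₂ i))
    (hy : w * (s * p ^ 2) + (1 - w) * (t * q ^ 2) ≤ y * (1 - y)) :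
    1 ≤ N ^ 2 * (y * (1 - y) * ∏ i ∈ R, (w * z₁ i + (1 - w) * z₂ i)) ∧
    ((w * (s * p ^ 2) + (1 - w) * (t * q ^ 2) < y * (1 - y) ∨
      (0 < w ∧ w < 1 ∧ 1 < (N * p) ^ 2 * (s * ∏ i ∈ R, z₁ i) ∧
        1 < (N * q) ^ 2 * (t * ∏ i ∈ R, z₂ i))) →
      1 < N ^ 2 * (y * (1 - y) * ∏ i ∈ R, (w * z₁ i + (1 - w) * z₂ i))) := by
  have hw1' : 0 ≤ 1 - w := by linarith
  set X₁ := ∏ i ∈ R, z₁ i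
  set X₂ := ∏ i ∈ R, z₂ i
  set Y := ∏ i ∈ R, (w * z₁ i + (1 - w) * z₂ i) with hY
  set D := w * (s * p ^ 2) + (1 - w) * (t * q ^ 2) with hD
  have hX₁ : 0 < X₁ := Finset.prod_pos hz₁
  have hX₂ : 0 < X₂ := Finset.prod_pos hz₂
  have hXY : X₁ ^ w * X₂ ^ (1 - w) ≤ Y := by
    rw [← Real.finsetProd_rpow _ _ (fun i hi => (hz₁ i hi).le),
      ← Real.finsetProd_rpow _ _ (fun i hi => (hz₂ i hi).le), ← Finset.prod_mul_distrib]
    refine Finset.prod_le_prod (fun i hi => ?_) fun i hi => ?_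
    · have := hz₁ i hi
      have := hz₂ i hi
      positivity
    · exact Real.geom_mean_le_arith_mean2_weighted hw0 hw1' (hz₁ i hi).le (hz₂ i hi).le (by ring)
  have hYpos : 0 < Y := lt_of_lt_of_le (by positivity) hXY
  have hDD : (s * p ^ 2) ^ w * (t * q ^ 2) ^ (1 - w) ≤ D :=
    Real.geom_mean_le_arith_mean2_weighted hw0 hw1' (by positivity) (by positivity) (by ring)
  have hDpos : 0 < D := lt_of_lt_of_le (by positivity) hDD
  -- The exponents `w` and `1 - w` add up to `1`, so the weighted geometric mean of the two assumed
  -- bounds carries the factor `N²` exactly once.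
  have hsplit : ((N * p) ^ 2 * (s * X₁)) ^ w * ((N * q) ^ 2 * (t * X₂)) ^ (1 - w)
      = N ^ 2 * (((s * p ^ 2) ^ w * (t * q ^ 2) ^ (1 - w)) * (X₁ ^ w * X₂ ^ (1 - w))) := by
    have e1 : (N * p) ^ 2 * (s * X₁) = N ^ 2 * ((s * p ^ 2) * X₁) := by ring
    have e2 : (N * q) ^ 2 * (t * X₂) = N ^ 2 * ((t * q ^ 2) * X₂) := by ring
    rw [e1, e2, Real.mul_rpow (by positivity : (0 : ℝ) ≤ N ^ 2) (by positivity : 0 ≤ s * p ^ 2 * X₁),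
      Real.mul_rpow (by positivity : (0 : ℝ) ≤ N ^ 2) (by positivity : 0 ≤ t * q ^ 2 * X₂),
      Real.mul_rpow (by positivity) hX₁.le,
      Real.mul_rpow (by positivity) hX₂.le]
    have e3 : (N ^ 2) ^ w * (N ^ 2) ^ (1 - w) = N ^ 2 := by
      rw [← Real.rpow_add (by positivity)]
      simp
    calc _ = ((N ^ 2) ^ w * (N ^ 2) ^ (1 - w)) *
        (((s * p ^ 2) ^ w * (t * q ^ 2) ^ (1 - w)) * (X₁ ^ w * X₂ ^ (1 - w))) := by ring
      _ = _ := by rw [e3]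
  have hle : ((N * p) ^ 2 * (s * X₁)) ^ w * ((N * q) ^ 2 * (t * X₂)) ^ (1 - w)
      ≤ N ^ 2 * (D * Y) := by
    rw [hsplit]
    gcongr
  have hge : 1 ≤ ((N * p) ^ 2 * (s * X₁)) ^ w * ((N * q) ^ 2 * (t * X₂)) ^ (1 - w) :=
    one_le_mul_of_one_le_of_one_le (Real.one_le_rpow h₁ hw0) (Real.one_le_rpow h₂ hw1')
  have hle' : N ^ 2 * (D * Y) ≤ N ^ 2 * (y * (1 - y) * Y) := by gcongr
  refine ⟨hge.trans (hle.trans hle'), ?_⟩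
  -- Strictness comes either from the factor `y * (1 - y)` or from an assumed bound whose exponent
  -- `1 - w` is positive.
  rintro (h | ⟨hw, hw', h, h'⟩)
  · refine (hge.trans hle).trans_lt ?_
    gcongr
  · exact (one_lt_mul (Real.one_le_rpow h₁ hw0)
      (Real.one_lt_rpow h' (by linarith))).trans_le (hle.trans hle')

/-! ### Hulls of chains and their extension by minimal elements. -/

section Chains

variable {P : Type*} [PartialOrder P]

/-- The convex hull of the characteristic vectors of the chains contained in `S`. -/
def chainHull (S : Finset P) : Set (P → ℝ) :=
  convexHull ℝ {x | ∃ C : Set P, C ⊆ S ∧ (incompGraph P).IsIndepSet C ∧ x = C.indicator 1}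

theorem isIndepSet_incompGraph_iff {C : Set P} :
    (incompGraph P).IsIndepSet C ↔ ∀ x ∈ C, ∀ y ∈ C, x ≤ y ∨ y ≤ x := by
  constructor
  · intro h x hx y hy
    by_cases hxy : x = y
    · exact Or.inl hxy.le
    · have := h hx hy hxy
      by_contra! h'
      exact this h'
  · rintro h x hx y hy - ⟨h1, h2⟩
    exact (h x hx y hy).elim h1 h2

theorem indicator_mem_chainHull {S : Finset P} {C : Set P} (hCS : C ⊆ S)
    (hC : ∀ x ∈ C, ∀ y ∈ C, x ≤ y ∨ y ≤ x) : C.indicator 1 ∈ chainHull S :=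
  subset_convexHull ℝ _ ⟨C, hCS, isIndepSet_incompGraph_iff.2 hC, rfl⟩

theorem chainHull_subset {S : Finset P} {K : Set (P → ℝ)} (hK : Convex ℝ K)
    (h : ∀ C : Set P, C ⊆ S → (∀ x ∈ C, ∀ y ∈ C, x ≤ y ∨ y ≤ x) → C.indicator 1 ∈ K) :
    chainHull S ⊆ K := by
  refine convexHull_min ?_ hK
  rintro _ ⟨C, hCS, hC, rfl⟩
  exact h C hCS (isIndepSet_incompGraph_iff.1 hC)

theorem chainHull_nonneg {S : Finset P} {x : P → ℝ} (hx : x ∈ chainHull S) (v : P) : 0 ≤ x v := by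
  have : chainHull S ⊆ Set.Ici (0 : P → ℝ) :=
    chainHull_subset (convex_Ici 0) fun C _ _ v => Set.indicator_nonneg (fun _ _ => zero_le_one) v
  exact this hx v

theorem chainHull_le_one {S : Finset P} {x : P → ℝ} (hx : x ∈ chainHull S) (v : P) : x v ≤ 1 := by
  have : chainHull S ⊆ Set.Iic (1 : P → ℝ) :=
    chainHull_subset (convex_Iic 1) fun C _ _ v =>
      Set.indicator_le_self' (fun _ _ => zero_le_one) v
  exact this hx v

theorem stab_add_le_one {V : Type*} {G : SimpleGraph V} {x : V → ℝ} (hx : x ∈ stabPolytope G)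
    {u v : V} (h : G.Adj u v) : x u + x v ≤ 1 := by
  classical
  have : stabPolytope G ⊆ {x | x u + x v ≤ 1} := by
    refine convexHull_min ?_ ?_
    · rintro _ ⟨C, hC, rfl⟩
      have : ¬ (u ∈ C ∧ v ∈ C) := fun ⟨hu, hv⟩ => hC hu hv h.ne h
      simp only [Set.mem_ofPred_eq, Set.indicator_apply, Pi.one_apply]
      split_ifs <;> first | (norm_num; done) | exact absurd ⟨‹_›, ‹_›⟩ this
    · intro x hx y hy a b ha hb hab
      simp only [Set.mem_ofPred_eq, Pi.add_apply, Pi.smul_apply, smul_eq_mul] at *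
      nlinarith
  exact this hx

theorem stab_le_one {V : Type*} {G : SimpleGraph V} {x : V → ℝ} (hx : x ∈ stabPolytope G)
    (v : V) : x v ≤ 1 := by
  have : stabPolytope G ⊆ Set.Iic (1 : V → ℝ) := by
    refine convexHull_min ?_ (convex_Iic 1)
    rintro _ ⟨C, -, rfl⟩ v
    exact Set.indicator_le_self' (fun _ _ => zero_le_one) v
  exact this hx v

theorem chainHull_subset_stab (S : Finset P) : chainHull S ⊆ stabPolytope (incompGraph P) := by
  refine convexHull_mono ?_
  rintro x ⟨C, -, hC, rfl⟩
  exact ⟨C, hC, rfl⟩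

/-- `S` contains an element incomparable with two others of `S`. -/
def HasCherry (S : Finset P) : Prop :=
  ∃ u ∈ S, ∃ v ∈ S, ∃ w ∈ S, v ≠ w ∧ IncompRel (· ≤ ·) u v ∧ IncompRel (· ≤ ·) u w

/-- If a minimal `a` is not below some `c`, a minimal element below `c` differs from `a`. -/
theorem exists_minimal_pair_or_least {S : Finset P} (hS : S.Nonempty) :
    (∃ a ∈ S, ∀ c ∈ S, a ≤ c) ∨
    ∃ a ∈ S, ∃ b ∈ S, a ≠ b ∧ (∀ c ∈ S, ¬ c < a) ∧ ∀ c ∈ S, ¬ c < b := by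
  obtain ⟨a, ha⟩ := S.exists_minimal hS
  by_cases h : ∀ c ∈ S, a ≤ c
  · exact Or.inl ⟨a, ha.1, h⟩
  · push Not at h
    obtain ⟨c, hc, hac⟩ := h
    obtain ⟨b, hbc, hb⟩ := S.exists_le_minimal hc
    refine Or.inr ⟨a, ha.1, b, hb.1, ?_, fun d hd => ha.not_lt hd, fun d hd => hb.not_lt hd⟩
    rintro rfl
    exact hac hbc

theorem incompRel_of_minimal {S : Finset P} {a b : P} (hab : a ≠ b) (ha : a ∈ S) (hb : b ∈ S)
    (hmina : ∀ c ∈ S, ¬ c < a) (hminb : ∀ c ∈ S, ¬ c < b) : IncompRel (· ≤ ·) a b :=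
  ⟨fun h => hminb a ha (lt_of_le_of_ne h hab), fun h => hmina b hb (lt_of_le_of_ne h hab.symm)⟩

variable [DecidableEq P]

/-- The hypotheses allow `a` and `b` at most each other as neighbours, so neither can be the centre
of a cherry, nor can `a` be one of its ends. -/
theorem HasCherry.erase {S : Finset P} {a b : P} (h : HasCherry S)
    (ha : ∀ c ∈ S, IncompRel (· ≤ ·) c a → c = b) (hb : ∀ c ∈ S, IncompRel (· ≤ ·) c b → c = a) :
    HasCherry (S.erase a) := by
  obtain ⟨u, hu, v, hv, w, hw, hvw, huv, huw⟩ := h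
  have hua : u ≠ a := by
    rintro rfl
    exact hvw ((ha v hv huv.symm).trans (ha w hw huw.symm).symm)
  have hub : u ≠ b := by
    rintro rfl
    exact hvw ((hb v hv huv.symm).trans (hb w hw huw.symm).symm)
  refine ⟨u, Finset.mem_erase.2 ⟨hua, hu⟩, v, Finset.mem_erase.2 ⟨?_, hv⟩, w,
    Finset.mem_erase.2 ⟨?_, hw⟩, hvw, huv, huw⟩
  · rintro rfl
    exact hub (ha u hu huv)
  · rintro rfl
    exact hub (ha u hu huw)

/-- A least element of `S` can be added to every chain of `S`. -/
theorem exists_chainHull_of_least {S : Finset P} {a : P} (ha : a ∈ S) (hmin : ∀ c ∈ S, a ≤ c)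
    {x : P → ℝ} (hx : x ∈ chainHull (S.erase a)) :
    ∃ z ∈ chainHull S, (∀ v ≠ a, z v = x v) ∧ z a = 1 := by
  have : chainHull (S.erase a) ⊆ {x | ∃ z ∈ chainHull S, (∀ v ≠ a, z v = x v) ∧ z a = 1} := by
    refine chainHull_subset ?_ fun C hCS hC => ?_
    · rintro x ⟨z, hz, h1, h2⟩ x' ⟨z', hz', h1', h2'⟩ c d hc hd hcd
      refine ⟨c • z + d • z', convex_convexHull ℝ _ hz hz' hc hd hcd, fun v hv => ?_, ?_⟩
      · simp only [Pi.add_apply, Pi.smul_apply, h1 v hv, h1' v hv]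
      · simp [h2, h2', hcd]
    · have hCS' : ∀ c ∈ C, c ∈ S := fun c hc => Finset.mem_of_mem_erase (hCS hc)
      refine ⟨(insert a C).indicator 1, indicator_mem_chainHull ?_ ?_, fun v hv => ?_, by simp⟩
      · rintro c (rfl | hc)
        · exact ha
        · exact hCS' c hc
      · rintro c (rfl | hc) d (rfl | hd)
        · exact Or.inl le_rfl
        · exact Or.inl (hmin d (hCS' d hd))
        · exact Or.inr (hmin c (hCS' c hc))
        · exact hC c hc d hd
      · classical
        simp [Set.indicator_apply, hv]
  exact this hx

/-- Every chain of `S \ {a}` can be extended by one of two minimal elements `a`, `b` of `S`, when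
`S` contains no three pairwise incomparable elements. -/
theorem exists_chainHull_of_minimal {S : Finset P} {a b : P} (ha : a ∈ S) (hb : b ∈ S)
    (hab : a ≠ b) (hA : ∀ c, IncompRel (· ≤ ·) c a → c ∈ S → b ≤ c)
    (hB : ∀ c, IncompRel (· ≤ ·) c b → c ∈ S → a ≤ c)
    {x : P → ℝ} (hx : x ∈ chainHull (S.erase a)) :
    ∃ z ∈ chainHull S, (∀ v, v ≠ a → x v ≤ z v) ∧ z a = 1 - z b := by
  have : chainHull (S.erase a) ⊆
      {x | ∃ z ∈ chainHull S, (∀ v, v ≠ a → x v ≤ z v) ∧ z a = 1 - z b} := by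
    refine chainHull_subset ?_ fun C hCS hC => ?_
    · rintro x ⟨z, hz, h1, h2⟩ x' ⟨z', hz', h1', h2'⟩ c d hc hd hcd
      refine ⟨c • z + d • z', convex_convexHull ℝ _ hz hz' hc hd hcd, fun v hv => ?_, ?_⟩
      · have := h1 v hv
        have := h1' v hv
        simp only [Pi.add_apply, Pi.smul_apply, smul_eq_mul]
        gcongr
      · simp only [Pi.add_apply, Pi.smul_apply, smul_eq_mul, h2, h2']
        linear_combination hcd
    · have hCS' : ∀ c ∈ C, c ∈ S := fun c hc => Finset.mem_of_mem_erase (hCS hc)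
      have haC : a ∉ C := fun h => by simpa using hCS h
      -- Add `b` if it is comparable with all of `C` (it may already lie there); otherwise add `a`.
      by_cases hCb : ∀ c ∈ C, b ≤ c ∨ c ≤ b
      · refine ⟨_, indicator_mem_chainHull (C := insert b C) ?_ ?_, fun v hv => ?_, ?_⟩
        · rintro c (rfl | hc)
          · exact hb
          · exact hCS' c hc
        · rintro c (rfl | hc) d (rfl | hd)
          · exact Or.inl le_rfl
          · exact hCb d hd
          · exact (hCb c hc).symm
          · exact hC c hc d hd
        · exact Set.indicator_le_indicator_of_subset (Set.subset_insert _ _)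
            (fun _ => zero_le_one) v
        · simp [hab, haC]
      · push Not at hCb
        obtain ⟨c, hc, hbc, hcb⟩ := hCb
        have hac := hB c ⟨hcb, hbc⟩ (hCS' c hc)
        -- If `d` were incomparable with `a`, then `b ≤ d`, while `a ≤ c`; comparing `c` and `d`
        -- within the chain would give `a ≤ d` or `b ≤ c`.
        have hCa : ∀ d ∈ C, a ≤ d ∨ d ≤ a := by
          intro d hd
          by_contra! h
          have hbd := hA d ⟨h.2, h.1⟩ (hCS' d hd)
          rcases hC c hc d hd with hcd | hdc
          · exact h.1 (hac.trans hcd)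
          · exact hbc (hbd.trans hdc)
        have hbC : b ∉ C := fun h => (hC c hc b h).elim hcb hbc
        refine ⟨_, indicator_mem_chainHull (C := insert a C) ?_ ?_, fun v hv => ?_, ?_⟩
        · rintro c (rfl | hc)
          · exact ha
          · exact hCS' c hc
        · rintro c (rfl | hc) d (rfl | hd)
          · exact Or.inl le_rfl
          · exact hCa d hd
          · exact (hCa c hc).symm
          · exact hC c hc d hd
        · exact Set.indicator_le_indicator_of_subset (Set.subset_insert _ _)
            (fun _ => zero_le_one) v
        · simp [hab.symm, hbC]
  exact this hx

/-! ### Counting linear extensions by their first element. -/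

/-- The linear extensions of the subposet `S`, as lists. -/
def linExtLists (S : Finset P) : Set (List P) :=
  {l | l.Nodup ∧ l.toFinset = S ∧ l.Pairwise fun x y => ¬ y < x}

theorem linExtLists_finite (S : Finset P) : (linExtLists S).Finite := by
  refine (List.finite_length_eq S S.card |>.image (List.map Subtype.val)).subset ?_
  rintro l ⟨hl, hS, -⟩
  refine ⟨l.attach.map fun x => ⟨x.1, hS ▸ List.mem_toFinset.2 x.2⟩, ?_, ?_⟩
  · simp [← hS, List.toFinset_card_of_nodup hl]
  · simp [Function.comp_def]

theorem cons_mem_linExtLists {S : Finset P} {a : P} (ha : a ∈ S) (hmin : ∀ c ∈ S, ¬ c < a)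
    {l : List P} (hl : l ∈ linExtLists (S.erase a)) : a :: l ∈ linExtLists S := by
  obtain ⟨h1, h2, h3⟩ := hl
  refine ⟨List.nodup_cons.2 ⟨fun h => ?_, h1⟩, ?_, List.pairwise_cons.2 ⟨fun c hc => ?_, h3⟩⟩
  · have := List.mem_toFinset.2 h
    simp [h2] at this
  · simp [h2, Finset.insert_erase ha]
  · refine hmin c ?_
    have := List.mem_toFinset.2 hc
    rw [h2] at this
    exact Finset.mem_of_mem_erase this

theorem ncard_linExtLists_erase_le {S : Finset P} {a : P} (ha : a ∈ S)
    (hmin : ∀ c ∈ S, ¬ c < a) :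
    (linExtLists (S.erase a)).ncard ≤ (linExtLists S).ncard :=
  Set.ncard_le_ncard_of_injOn (List.cons a) (fun _ hl => cons_mem_linExtLists ha hmin hl)
    (fun _ _ _ _ h => List.cons_injective h) (linExtLists_finite S)

/-- Prepending the removed minimal element gives linear extensions of `S`, and the first entry tells
the two families apart. -/
theorem ncard_linExtLists_erase_add_le {S : Finset P} {a b : P} (hab : a ≠ b) (ha : a ∈ S)
    (hb : b ∈ S) (hmina : ∀ c ∈ S, ¬ c < a) (hminb : ∀ c ∈ S, ¬ c < b) :
    (linExtLists (S.erase a)).ncard + (linExtLists (S.erase b)).ncard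
      ≤ (linExtLists S).ncard := by
  rw [← Set.ncard_image_of_injective _ (List.cons_injective (a := a)),
    ← Set.ncard_image_of_injective (linExtLists (S.erase b)) (List.cons_injective (a := b)),
    ← Set.ncard_union_eq ?_ ((linExtLists_finite _).image _) ((linExtLists_finite _).image _)]
  · refine Set.ncard_le_ncard ?_ (linExtLists_finite S)
    rintro _ (⟨l, hl, rfl⟩ | ⟨l, hl, rfl⟩)
    · exact cons_mem_linExtLists ha hmina hl
    · exact cons_mem_linExtLists hb hminb hl
  · rw [Set.disjoint_left]
    rintro _ ⟨l, -, rfl⟩ ⟨l', -, h⟩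
    exact hab (List.cons.inj h).1.symm


theorem linExtLists_nonempty (S : Finset P) : (linExtLists S).Nonempty := by
  induction S using Finset.strongInduction with
  | H S ih =>
  rcases S.eq_empty_or_nonempty with rfl | hS
  · exact ⟨[], by simp [linExtLists]⟩
  · obtain ⟨a, ha⟩ := S.exists_minimal hS
    obtain ⟨l, hl⟩ := ih _ (Finset.erase_ssubset ha.1)
    exact ⟨_, cons_mem_linExtLists ha.1 (fun c hc => ha.not_lt hc) hl⟩

/-! ### The inductive construction of a good point in the chain hull. -/

/-- In a poset without three pairwise incomparable elements, some point of the chain hull has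
product of coordinates at least `e(S)⁻²`, and more than that if some element is incomparable with two
others. -/
theorem exists_chainHull_prod
    (h3 : ∀ a b c : P, IncompRel (· ≤ ·) a b → IncompRel (· ≤ ·) a c → IncompRel (· ≤ ·) b c → False)
    (S : Finset P) :
    ∃ x ∈ chainHull S, 1 ≤ ((linExtLists S).ncard : ℝ) ^ 2 * ∏ v ∈ S, x v ∧
      (HasCherry S → 1 < ((linExtLists S).ncard : ℝ) ^ 2 * ∏ v ∈ S, x v) := by
  induction S using Finset.strongInduction with
  | H S ih =>
  rcases S.eq_empty_or_nonempty with rfl | hS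
  · refine ⟨(∅ : Set P).indicator 1, indicator_mem_chainHull (by simp) (by simp), ?_, ?_⟩
    · have : (linExtLists (∅ : Finset P)) = {[]} := by
        ext l
        constructor
        · rintro ⟨-, h, -⟩
          simpa using h
        · rintro rfl
          simp [linExtLists]
      simp [this]
    · rintro ⟨u, hu, -⟩
      simp at hu
  have hpos : ∀ a ∈ S, ∀ x ∈ chainHull (S.erase a),
      1 ≤ ((linExtLists (S.erase a)).ncard : ℝ) ^ 2 * ∏ v ∈ S.erase a, x v →
      ∀ v ∈ S.erase a, 0 < x v := by
    intro a _ x hx h v hv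
    refine lt_of_le_of_ne (chainHull_nonneg hx v) fun h0 => ?_
    rw [Finset.prod_eq_zero hv h0.symm] at h
    norm_num at h
  rcases exists_minimal_pair_or_least hS with ⟨a, ha, hmin⟩ | ⟨a, ha, b, hb, hab, hmina, hminb⟩
  · obtain ⟨x, hx, hx1, hx2⟩ := ih _ (Finset.erase_ssubset ha)
    obtain ⟨z, hz, hzx, hza⟩ := exists_chainHull_of_least ha hmin hx
    have hprod : ∏ v ∈ S, z v = ∏ v ∈ S.erase a, x v := by
      rw [← Finset.mul_prod_erase S z ha, hza, one_mul]
      exact Finset.prod_congr rfl fun v hv => hzx v (Finset.ne_of_mem_erase hv)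
    have hcard : ((linExtLists (S.erase a)).ncard : ℝ) ≤ (linExtLists S).ncard := by
      exact_mod_cast ncard_linExtLists_erase_le ha fun c hc h => h.not_ge (hmin c hc)
    have hle : ((linExtLists (S.erase a)).ncard : ℝ) ^ 2 * ∏ v ∈ S.erase a, x v
        ≤ ((linExtLists S).ncard : ℝ) ^ 2 * ∏ v ∈ S, z v := by
      rw [hprod]
      have : 0 ≤ ∏ v ∈ S.erase a, x v := Finset.prod_nonneg fun v _ => chainHull_nonneg hx v
      gcongr
    -- A least element is comparable with everything, so both hypotheses of `HasCherry.erase` are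
    -- vacuous and `a` serves as a dummy value for `b`.
    refine ⟨z, hz, hx1.trans hle, fun h => (hx2 (h.erase (b := a) ?_ ?_)).trans_le hle⟩ <;>
    exact fun c hc h => absurd (hmin c hc) h.2
  · have hinc := incompRel_of_minimal hab ha hb hmina hminb
    have hA : ∀ c, IncompRel (· ≤ ·) c a → c ∈ S → b ≤ c := by
      intro c hca hc
      by_contra h
      refine h3 a b c hinc hca.symm ⟨h, fun h' => ?_⟩
      exact hminb c hc (lt_of_le_not_ge h' h)
    have hB : ∀ c, IncompRel (· ≤ ·) c b → c ∈ S → a ≤ c := by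
      intro c hcb hc
      by_contra h
      refine h3 b a c hinc.symm hcb.symm ⟨h, fun h' => ?_⟩
      exact hmina c hc (lt_of_le_not_ge h' h)
    obtain ⟨x₁, hx₁, hx₁1, hx₁2⟩ := ih _ (Finset.erase_ssubset ha)
    obtain ⟨x₂, hx₂, hx₂1, hx₂2⟩ := ih _ (Finset.erase_ssubset hb)
    obtain ⟨z₁, hz₁, hzx₁, hza⟩ := exists_chainHull_of_minimal ha hb hab hA hB hx₁
    obtain ⟨z₂, hz₂, hzx₂, hzb⟩ := exists_chainHull_of_minimal hb ha hab.symm hB hA hx₂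
    have hz₁0 : ∀ v ∈ S.erase a, 0 < z₁ v := fun v hv =>
      (hpos a ha x₁ hx₁ hx₁1 v hv).trans_le (hzx₁ v (Finset.ne_of_mem_erase hv))
    have hz₂0 : ∀ v ∈ S.erase b, 0 < z₂ v := fun v hv =>
      (hpos b hb x₂ hx₂ hx₂1 v hv).trans_le (hzx₂ v (Finset.ne_of_mem_erase hv))
    have hbSa : b ∈ S.erase a := Finset.mem_erase.2 ⟨hab.symm, hb⟩
    have haSb : a ∈ S.erase b := Finset.mem_erase.2 ⟨hab, ha⟩
    set R := (S.erase a).erase b with hR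
    have hR' : (S.erase b).erase a = R := Finset.erase_right_comm
    set N₁ : ℝ := ((linExtLists (S.erase a)).ncard : ℝ)
    set N₂ : ℝ := ((linExtLists (S.erase b)).ncard : ℝ)
    have hN₁ : 0 < N₁ := by
      simp only [N₁]
      exact_mod_cast (Set.ncard_pos (linExtLists_finite _)).2 (linExtLists_nonempty (S.erase a))
    have hN₂ : 0 < N₂ := by
      simp only [N₂]
      exact_mod_cast (Set.ncard_pos (linExtLists_finite _)).2 (linExtLists_nonempty (S.erase b))
    have hN : N₁ + N₂ ≤ (linExtLists S).ncard := by
      simp only [N₁, N₂]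
      exact_mod_cast ncard_linExtLists_erase_add_le hab ha hb hmina hminb
    have hle₁ : N₁ ^ 2 * ∏ v ∈ S.erase a, x₁ v ≤ N₁ ^ 2 * (z₁ b * ∏ v ∈ R, z₁ v) := by
      rw [Finset.mul_prod_erase _ _ hbSa]
      gcongr with v hv
      · exact fun v _ => chainHull_nonneg hx₁ v
      · exact hzx₁ v (Finset.ne_of_mem_erase hv)
    have hle₂ : N₂ ^ 2 * ∏ v ∈ S.erase b, x₂ v ≤ N₂ ^ 2 * (z₂ a * ∏ v ∈ R, z₂ v) := by
      rw [← hR', Finset.mul_prod_erase _ _ haSb]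
      gcongr with v hv
      · exact fun v _ => chainHull_nonneg hx₂ v
      · exact hzx₂ v (Finset.ne_of_mem_erase hv)
    -- Here `s = z₁ b` and `t = z₂ a`, so `y` is the averaged coordinate at `a` and `1 - y` the one
    -- at `b`; `p` and `q` are the shares of the two counts in their sum.
    obtain ⟨w, y, hw0, hw1, hy, hle, hlt⟩ := exists_weight (p := N₁ / (N₁ + N₂))
      (q := N₂ / (N₁ + N₂)) (by positivity) (by positivity) (by field_simp)
      (hz₁0 b hbSa) (chainHull_le_one hz₁ b) (hz₂0 a haSb) (chainHull_le_one hz₂ a)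
    have hp : (N₁ + N₂) * (N₁ / (N₁ + N₂)) = N₁ := by field_simp
    have hq : (N₁ + N₂) * (N₂ / (N₁ + N₂)) = N₂ := by field_simp
    obtain ⟨hone, hone'⟩ := one_le_sq_mul_prod_average R (N := N₁ + N₂) (z₁ := z₁) (z₂ := z₂)
      (by positivity) (fun v hv => hz₁0 v (Finset.mem_of_mem_erase hv))
      (fun v hv => hz₂0 v (Finset.mem_of_mem_erase (hR' ▸ hv))) (by positivity) (by positivity)
      (hz₁0 b hbSa) (hz₂0 a haSb) hw0 hw1 (by rw [hp]; exact hx₁1.trans hle₁)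
      (by rw [hq]; exact hx₂1.trans hle₂) hle
    rw [hp, hq] at hone'
    have hz : w • z₁ + (1 - w) • z₂ ∈ chainHull S :=
      convex_convexHull ℝ _ hz₁ hz₂ hw0 (by linarith) (by ring)
    have hprod : ∏ v ∈ S, (w • z₁ + (1 - w) • z₂) v
        = y * (1 - y) * ∏ v ∈ R, (w * z₁ v + (1 - w) * z₂ v) := by
      rw [← Finset.mul_prod_erase S _ ha, ← Finset.mul_prod_erase (S.erase a) _ hbSa, ← mul_assoc]
      simp only [Pi.add_apply, Pi.smul_apply, smul_eq_mul, hza, hzb, hy]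
      congr 1
      ring
    have hfin : (N₁ + N₂) ^ 2 * (y * (1 - y) * ∏ v ∈ R, (w * z₁ v + (1 - w) * z₂ v))
        ≤ ((linExtLists S).ncard : ℝ) ^ 2 * ∏ v ∈ S, (w • z₁ + (1 - w) • z₂) v := by
      rw [← hprod]
      have : 0 ≤ ∏ v ∈ S, (w • z₁ + (1 - w) • z₂) v :=
        Finset.prod_nonneg fun v _ => chainHull_nonneg hz v
      gcongr
    refine ⟨_, hz, hone.trans hfin, fun hch => (hone' ?_).trans_le hfin⟩
    rcases hlt with hlt | ⟨hs, ht, hw, hw'⟩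
    · exact Or.inl hlt
    -- In the tight case `z₁ b = z₂ a = 1`. A further element incomparable with `b` or `a` would
    -- have coordinate at most `0` in `z₁` or `z₂`, against positivity. Hence the cherry avoids
    -- both, and induction supplies strictness.
    · have hbc : ∀ c ∈ S, IncompRel (· ≤ ·) c b → c = a := by
        intro c hc h
        by_contra hca
        have h1 := stab_add_le_one (chainHull_subset_stab S hz₁) (u := c) (v := b) h
        have h2 := hz₁0 c (Finset.mem_erase.2 ⟨hca, hc⟩)
        linarith
      have hac : ∀ c ∈ S, IncompRel (· ≤ ·) c a → c = b := by
        intro c hc h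
        by_contra hcb
        have h1 := stab_add_le_one (chainHull_subset_stab S hz₂) (u := c) (v := a) h
        have h2 := hz₂0 c (Finset.mem_erase.2 ⟨hcb, hc⟩)
        linarith
      exact Or.inr ⟨hw, hw', (hx₁2 (hch.erase hac hbc)).trans_le hle₁,
        (hx₂2 (hch.erase hbc hac)).trans_le hle₂⟩

/-- Sending each element to its position in the list is injective. Only this inequality is needed,
since the entropy is bounded above in terms of `e(P)`. -/
theorem ncard_linExtLists_univ_le [Fintype P] :
    (linExtLists (Finset.univ : Finset P)).ncard ≤ numLinearExtensions P := by
  rw [numLinearExtensions, ← Nat.card_coe_set_eq]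
  have hlen : ∀ l : linExtLists (Finset.univ : Finset P), l.1.length = Fintype.card P := by
    rintro ⟨l, h1, h2, -⟩
    rw [← List.toFinset_card_of_nodup h1, h2, Finset.card_univ]
  have hmem : ∀ l : linExtLists (Finset.univ : Finset P), ∀ v, v ∈ l.1 := by
    rintro ⟨l, -, h2, -⟩ v
    rw [← List.mem_toFinset, h2]
    exact Finset.mem_univ v
  let F : linExtLists (Finset.univ : Finset P) → (P ≃ Fin (Fintype.card P)) := fun l =>
    (List.Nodup.getEquivOfForallMemList l.1 l.2.1 (hmem l)).symm.trans (finCongr (hlen l))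
  have hF : ∀ l i, (F l).symm i = l.1.get (Fin.cast (hlen l).symm i) := fun l i => rfl
  have hmono : ∀ l, Monotone (F l) := by
    intro l x y hxy
    by_contra! hlt
    have := List.pairwise_iff_get.1 l.2.2.2 (Fin.cast (hlen l).symm (F l y))
      (Fin.cast (hlen l).symm (F l x)) hlt
    rw [← hF, ← hF, Equiv.symm_apply_apply, Equiv.symm_apply_apply] at this
    refine this (lt_of_le_of_ne hxy ?_)
    rintro rfl
    exact lt_irrefl _ hlt
  refine Nat.card_le_card_of_injective (fun l => ⟨F l, hmono l⟩) fun l l' h => ?_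
  have h' : F l = F l' := congrArg Subtype.val h
  refine Subtype.ext (List.ext_get ((hlen l).trans (hlen l').symm) fun n h1 h2 => ?_)
  have := hF l ⟨n, hlen l ▸ h1⟩
  rw [h', hF] at this
  exact this.symm

theorem numLinearExtensions_pos {P : Type*} [PartialOrder P] [Fintype P] :
    0 < numLinearExtensions P := by
  classical
  exact ((Set.ncard_pos (linExtLists_finite Finset.univ)).2 (linExtLists_nonempty _)).trans_le
    ncard_linExtLists_univ_le

/-! ### Decomposition into an ordinal sum. -/

/-- A finset in which every element is incomparable with at most one other is an ordinal sum of
antichains with one or two elements. -/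
theorem exists_ordinalSum_of_not_hasCherry (S : Finset P) (h : ¬ HasCherry S) :
    ∃ (k : ℕ) (A : Fin k → Finset P),
      (∀ i, IsAntichain (· ≤ ·) (A i : Set P)) ∧
      (∀ i, (A i).card = 1 ∨ (A i).card = 2) ∧
      (∀ x ∈ S, ∃! i, x ∈ A i) ∧ (∀ i, A i ⊆ S) ∧
      (∀ i j, i < j → ∀ x ∈ A i, ∀ y ∈ A j, x < y) := by
  induction S using Finset.strongInduction with
  | H S ih =>
  rcases S.eq_empty_or_nonempty with rfl | hS
  · exact ⟨0, fun _ => ∅, fun i => i.elim0, fun i => i.elim0, by simp, fun i => i.elim0,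
      fun i => i.elim0⟩
  -- The bottom block is the least element or the two minimal elements. In the second case an
  -- outside element not above both would form a cherry with them.
  obtain ⟨B, hBS, hBne, hBa, hBc, hBlt⟩ : ∃ B ⊆ S, B.Nonempty ∧ IsAntichain (· ≤ ·) (B : Set P) ∧
      (B.card = 1 ∨ B.card = 2) ∧ ∀ x ∈ B, ∀ y ∈ S \ B, x < y := by
    rcases exists_minimal_pair_or_least hS with ⟨a, ha, hmin⟩ | ⟨a, ha, b, hb, hab, hmina, hminb⟩
    · refine ⟨{a}, by simpa, by simp, by simp, by simp, fun x hx y hy => ?_⟩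
      simp only [Finset.mem_singleton, Finset.mem_sdiff] at hx hy
      exact hx ▸ lt_of_le_of_ne (hmin y hy.1) (Ne.symm hy.2)
    · have hinc := incompRel_of_minimal hab ha hb hmina hminb
      refine ⟨{a, b}, by simp [Finset.insert_subset_iff, ha, hb], by simp, ?_,
        Or.inr (Finset.card_pair hab), fun x hx y hy => ?_⟩
      · intro x hx y hy hxy
        simp only [Finset.coe_insert, Finset.coe_singleton, Set.mem_insert_iff,
          Set.mem_singleton_iff] at hx hy
        rcases hx with rfl | rfl <;> rcases hy with rfl | rfl
        · exact absurd rfl hxy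
        · exact hinc.1
        · exact hinc.2
        · exact absurd rfl hxy
      · simp only [Finset.mem_insert, Finset.mem_singleton, Finset.mem_sdiff, not_or] at hx hy
        obtain ⟨hyS, hya, hyb⟩ := hy
        rcases hx with rfl | rfl
        · by_contra hlt
          exact h ⟨x, ha, b, hb, y, hyS, Ne.symm hyb, hinc,
            fun h' => hlt (lt_of_le_of_ne h' (Ne.symm hya)),
            fun h' => hmina y hyS (lt_of_le_of_ne h' hya)⟩
        · by_contra hlt
          exact h ⟨x, hb, a, ha, y, hyS, Ne.symm hya, hinc.symm,
            fun h' => hlt (lt_of_le_of_ne h' (Ne.symm hyb)),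
            fun h' => hminb y hyS (lt_of_le_of_ne h' hyb)⟩
  have hsub : S \ B ⊂ S := Finset.sdiff_ssubset hBS hBne
  obtain ⟨k, A, h1, h2, h3, h4, h5⟩ := ih _ hsub fun ⟨u, hu, v, hv, w, hw, h'⟩ =>
    h ⟨u, hsub.1 hu, v, hsub.1 hv, w, hsub.1 hw, h'⟩
  refine ⟨k + 1, Fin.cons B A, ?_, ?_, ?_, ?_, ?_⟩
  · exact fun i => Fin.cases hBa h1 i
  · exact fun i => Fin.cases hBc h2 i
  · intro x hx
    by_cases hxB : x ∈ B
    · refine ⟨0, hxB, fun i => Fin.cases (fun _ => rfl) (fun i hi => ?_) i⟩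
      exact absurd hxB (Finset.mem_sdiff.1 (h4 i hi)).2
    · obtain ⟨i, hi, huniq⟩ := h3 x (Finset.mem_sdiff.2 ⟨hx, hxB⟩)
      refine ⟨i.succ, hi, fun j => Fin.cases (fun hj => absurd hj hxB) (fun j hj => ?_) j⟩
      exact congrArg Fin.succ (huniq j hj)
  · exact fun i => Fin.cases hBS (fun i => (h4 i).trans hsub.1) i
  · intro i j
    refine Fin.cases (fun hij => ?_) (fun i => ?_) i
    · refine Fin.cases (fun hij => absurd hij (lt_irrefl _)) (fun j _ x hx y hy => ?_) j hij
      exact hBlt x hx y (h4 j hy)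
    · refine Fin.cases (fun hij => absurd hij (Fin.not_lt_zero _)) (fun j hij x hx y hy => ?_) j
      exact h5 i j (Fin.succ_lt_succ_iff.1 hij) x hx y hy

end Chains

/-! ### Bounds on graph entropy. -/

section Entropy

variable {V : Type*} [Fintype V]

theorem card_mul_graphEntropy_le [Nonempty V] {G : SimpleGraph V} {x : V → ℝ}
    (hx : x ∈ stabPolytope G) (hx0 : ∀ v, 0 < x v) :
    (Fintype.card V : ℝ) * graphEntropy G ≤ -∑ v, Real.logb 2 (x v) := by
  have hn : (0 : ℝ) < Fintype.card V := by exact_mod_cast Fintype.card_pos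
  have h := (graphEntropy_isLeast G).2 ⟨x, ⟨hx, hx0⟩, rfl⟩
  simp only [← Finset.mul_sum] at h
  calc _ ≤ (Fintype.card V : ℝ) * -(1 / (Fintype.card V : ℝ) * ∑ v, Real.logb 2 (x v)) := by gcongr
    _ = _ := by field_simp

theorem exists_card_mul_graphEntropy_eq [Nonempty V] (G : SimpleGraph V) :
    ∃ x ∈ stabPolytope G, (∀ v, 0 < x v) ∧
      (Fintype.card V : ℝ) * graphEntropy G = -∑ v, Real.logb 2 (x v) := by
  have hn : (0 : ℝ) < Fintype.card V := by exact_mod_cast Fintype.card_pos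
  obtain ⟨x, ⟨hx, hx0⟩, h⟩ := (graphEntropy_isLeast G).1
  refine ⟨x, hx, hx0, ?_⟩
  rw [← h]
  simp only [← Finset.mul_sum]
  field_simp

theorem two_le_neg_logb_add {x y : ℝ} (hx : 0 < x) (hy : 0 < y) (h : x + y ≤ 1) :
    2 ≤ -Real.logb 2 x + -Real.logb 2 y := by
  have h1 : x * y ≤ 2 ^ (-2 : ℝ) := by
    rw [Real.rpow_neg (by norm_num)]
    norm_num
    nlinarith [sq_nonneg (x - y)]
  have h2 := Real.logb_le_logb_of_le (b := 2) (by norm_num) (by positivity) h1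
  rw [Real.logb_rpow (by norm_num) (by norm_num), Real.logb_mul hx.ne' hy.ne'] at h2
  linarith

/-- A graph of maximum degree at most one has entropy at least `2 |E| / |V|`. -/
theorem two_mul_card_edges_le [Nonempty V] {G : SimpleGraph V} [DecidableRel G.Adj]
    (hG : G.maxDegree ≤ 1) :
    2 * (G.edgeFinset.card : ℝ) ≤ (Fintype.card V : ℝ) * graphEntropy G := by
  classical
  obtain ⟨x, hx, hx0, h⟩ := exists_card_mul_graphEntropy_eq G
  rw [h, ← Finset.sum_neg_distrib]
  set l : V → ℝ := fun v => -Real.logb 2 (x v) with hl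
  have hl0 : ∀ v, 0 ≤ l v := fun v =>
    neg_nonneg.2 (Real.logb_nonpos (by norm_num) (hx0 v).le (stab_le_one hx v))
  have hdeg : ∀ v, (G.degree v : ℝ) ≤ 1 := fun v => by
    exact_mod_cast (G.degree_le_maxDegree v).trans hG
  -- Double counting over ordered adjacent pairs: each vertex is counted at most once in `h1`, and
  -- each edge contributes `2` in both orientations in `h3`.
  have h1 : ∑ v, ∑ u, (if G.Adj v u then l v else 0) ≤ ∑ v, l v := by
    refine Finset.sum_le_sum fun v _ => ?_
    rw [← Finset.sum_filter, Finset.sum_const, nsmul_eq_mul, ← G.neighborFinset_eq_filter,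
      G.card_neighborFinset_eq_degree]
    exact mul_le_of_le_one_left (hl0 v) (hdeg v)
  have h2 : ∑ v, ∑ u, (if G.Adj v u then l v else 0)
      = ∑ v, ∑ u, (if G.Adj v u then l u else 0) := by
    rw [Finset.sum_comm]
    simp only [G.adj_comm]
  have h3 : ∑ v, ∑ u, (if G.Adj v u then (2 : ℝ) else 0)
      ≤ ∑ v, ∑ u, (if G.Adj v u then l v else 0) + ∑ v, ∑ u, (if G.Adj v u then l u else 0) := by
    simp only [← Finset.sum_add_distrib]
    refine Finset.sum_le_sum fun v _ => Finset.sum_le_sum fun u _ => ?_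
    split_ifs with huv
    · exact two_le_neg_logb_add (hx0 v) (hx0 u) (stab_add_le_one hx huv)
    · simp
  have h4 : ∑ v, ∑ u, (if G.Adj v u then (2 : ℝ) else 0) = 2 * (2 * G.edgeFinset.card) := by
    have : (∑ v, (G.degree v : ℝ)) = 2 * G.edgeFinset.card := by
      exact_mod_cast G.sum_degrees_eq_twice_card_edges
    rw [← this, Finset.mul_sum]
    refine Finset.sum_congr rfl fun v _ => ?_
    rw [← Finset.sum_filter, Finset.sum_const, nsmul_eq_mul, ← G.neighborFinset_eq_filter,
      G.card_neighborFinset_eq_degree, mul_comm]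
  linarith

end Entropy

/-! ### Width two posets and the equality case. -/

section Main

variable {P : Type*} [PartialOrder P] [Fintype P]

/-- A linear extension is determined by its order on the incomparable pairs. -/
theorem numLinearExtensions_le_two_pow [DecidableRel (incompGraph P).Adj] :
    numLinearExtensions P ≤ 2 ^ (incompGraph P).edgeFinset.card := by
  classical
  -- Each edge gets an arbitrary orientation from `Sym2` representatives; `F` records whether the
  -- linear extension follows it.
  let F : {f : P ≃ Fin (Fintype.card P) // Monotone f} → (incompGraph P).edgeFinset → Bool :=
    fun f e => decide (f.1 e.1.out.1 < f.1 e.1.out.2)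
  have hF : Function.Injective F := by
    rintro ⟨f, hf⟩ ⟨g, hg⟩ h
    have key : ∀ u v, f u < f v → g u < g v := by
      intro u v huv
      have hne : u ≠ v := by
        rintro rfl
        exact lt_irrefl _ huv
      by_cases h1 : u ≤ v
      · exact lt_of_le_of_ne (hg h1) (g.injective.ne hne)
      by_cases h2 : v ≤ u
      · exact absurd (hf h2) huv.not_ge
      have he : s(u, v) ∈ (incompGraph P).edgeFinset := by
        rw [SimpleGraph.mem_edgeFinset, SimpleGraph.mem_edgeSet]
        exact ⟨h1, h2⟩
      have := congrFun h ⟨s(u, v), he⟩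
      simp only [F, decide_eq_decide] at this
      have hout : s((s(u, v)).out.1, (s(u, v)).out.2) = s(u, v) := Quot.out_eq _
      rcases Sym2.eq_iff.1 hout with ⟨e1, e2⟩ | ⟨e1, e2⟩
      · rw [e1, e2] at this
        exact this.1 huv
      · rw [e1, e2] at this
        have h3 : ¬ g v < g u := fun h' => (this.2 h').not_gt huv
        exact lt_of_le_of_ne (not_lt.1 h3) (g.injective.ne hne)
    -- Two extensions with the same record differ by a strictly increasing permutation of `Fin`,
    -- which is the identity.
    have hmono : StrictMono (f.symm.trans g) := fun i j hij => key _ _ (by simpa using hij)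
    have hid : ∀ i, (f.symm.trans g) i = i := by
      let φ : Fin (Fintype.card P) ≃o Fin (Fintype.card P) :=
        hmono.orderIsoOfSurjective _ (f.symm.trans g).surjective
      intro i
      have : φ = OrderIso.refl _ := Subsingleton.elim _ _
      exact congrArg (fun ψ : Fin (Fintype.card P) ≃o Fin (Fintype.card P) => ψ i) this
    refine Subtype.ext (Equiv.ext fun v => ?_)
    simpa using (hid (f v)).symm
  calc numLinearExtensions P ≤ Nat.card ((incompGraph P).edgeFinset → Bool) :=
        Nat.card_le_card_of_injective F hF
    _ = _ := by rw [Nat.card_eq_fintype_card, Fintype.card_fun, Fintype.card_bool, Fintype.card_coe]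

theorem incompRel_triple_of_posetWidth_le (h : posetWidth P ≤ 2) (a b c : P)
    (hab : IncompRel (· ≤ ·) a b) (hac : IncompRel (· ≤ ·) a c) (hbc : IncompRel (· ≤ ·) b c) :
    False := by
  classical
  have h1 : a ≠ b := fun e => hab.1 e.le
  have h2 : a ≠ c := fun e => hac.1 e.le
  have h3 : b ≠ c := fun e => hbc.1 e.le
  have hanti : IsAntichain (· ≤ ·) (({a, b, c} : Finset P) : Set P) := by
    intro x hx y hy hxy
    simp only [Finset.coe_insert, Finset.coe_singleton, Set.mem_insert_iff,
      Set.mem_singleton_iff] at hx hy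
    rcases hx with rfl | rfl | rfl <;> rcases hy with rfl | rfl | rfl <;>
      first
      | exact absurd rfl hxy
      | exact hab.1
      | exact hab.2
      | exact hac.1
      | exact hac.2
      | exact hbc.1
      | exact hbc.2
  have hc : ({a, b, c} : Finset P).card ≤ posetWidth P := by
    unfold posetWidth
    exact Finset.le_sup (f := Finset.card) (by simpa using hanti)
  rw [Finset.card_eq_three.2 ⟨a, b, c, h1, h2, h3, rfl⟩] at hc
  omega

theorem exists_incompRel_of_posetWidth (h : posetWidth P = 2) :
    ∃ a b : P, IncompRel (· ≤ ·) a b := by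
  classical
  obtain ⟨s, hs, hcard⟩ := Finset.exists_mem_eq_sup
    (Finset.univ.filter fun s : Finset P => IsAntichain (· ≤ ·) (s : Set P)) ⟨∅, by simp⟩
    Finset.card
  have h2 : s.card = 2 := by
    rw [← hcard, ← h]
    unfold posetWidth
    congr
  obtain ⟨a, b, hab, rfl⟩ := Finset.card_eq_two.1 h2
  have hanti := (Finset.mem_filter.1 hs).2
  exact ⟨a, b, hanti (by simp) (by simp) hab, hanti (by simp) (by simp) hab.symm⟩

theorem hasCherry_iff_two_le_maxDegree [DecidableRel (incompGraph P).Adj] :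
    HasCherry (Finset.univ : Finset P) ↔ 2 ≤ (incompGraph P).maxDegree := by
  classical
  constructor
  · rintro ⟨u, -, v, -, w, -, hvw, huv, huw⟩
    refine le_trans ?_ ((incompGraph P).degree_le_maxDegree u)
    rw [← SimpleGraph.card_neighborFinset_eq_degree]
    exact Finset.one_lt_card.2 ⟨v, (SimpleGraph.mem_neighborFinset _ _ _).2 huv, w,
      (SimpleGraph.mem_neighborFinset _ _ _).2 huw, hvw⟩
  · intro h
    have : Nonempty P := by
      by_contra hne
      rw [not_nonempty_iff] at hne
      simp at h
    obtain ⟨u, hu⟩ := (incompGraph P).exists_maximal_degree_vertex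
    rw [hu, ← SimpleGraph.card_neighborFinset_eq_degree] at h
    obtain ⟨v, hv, w, hw, hvw⟩ := Finset.one_lt_card.1 h
    exact ⟨u, Finset.mem_univ _, v, Finset.mem_univ _, w, Finset.mem_univ _, hvw,
      (SimpleGraph.mem_neighborFinset _ _ _).1 hv, (SimpleGraph.mem_neighborFinset _ _ _).1 hw⟩

/-- Elements incomparable with `u` lie in the block of `u`, so a cherry would put three elements in
one block. -/
theorem not_hasCherry_of_isOrdinalSum (h : IsOrdinalSumOfSmallAntichains P) :
    ¬ HasCherry (Finset.univ : Finset P) := by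
  classical
  obtain ⟨k, A, -, hcard, huniq, hlt⟩ := h
  rintro ⟨u, -, v, -, w, -, hvw, huv, huw⟩
  obtain ⟨i, hi, -⟩ := huniq u
  have hmem : ∀ c, IncompRel (· ≤ ·) u c → c ∈ A i := by
    intro c hc
    obtain ⟨j, hj, -⟩ := huniq c
    rcases lt_trichotomy i j with hij | rfl | hij
    · exact absurd (hlt i j hij u hi c hj).le hc.1
    · exact hj
    · exact absurd (hlt j i hij c hj u hi).le hc.2
  have hsub : ({u, v, w} : Finset P) ⊆ A i := by
    intro c hc
    simp only [Finset.mem_insert, Finset.mem_singleton] at hc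
    rcases hc with rfl | rfl | rfl
    · exact hi
    · exact hmem _ huv
    · exact hmem _ huw
  have h3 : ({u, v, w} : Finset P).card = 3 :=
    Finset.card_eq_three.2 ⟨u, v, w, fun e => huv.1 e.le, fun e => huw.1 e.le, hvw, rfl⟩
  have := Finset.card_le_card hsub
  have := hcard i
  omega

/-- The entropy of the incomparability graph of a width two poset is at most `2 log₂ e(P) / |P|`,
with strict inequality if some element is incomparable with two others. -/
theorem card_mul_graphEntropy_le_two_mul_logb [Nonempty P] (h : posetWidth P ≤ 2) :
    (Fintype.card P : ℝ) * graphEntropy (incompGraph P)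
        ≤ 2 * Real.logb 2 (numLinearExtensions P : ℝ) ∧
      (HasCherry (Finset.univ : Finset P) →
        (Fintype.card P : ℝ) * graphEntropy (incompGraph P)
          < 2 * Real.logb 2 (numLinearExtensions P : ℝ)) := by
  classical
  obtain ⟨x, hx, h1, h2⟩ :=
    exists_chainHull_prod (incompRel_triple_of_posetWidth_le h) (Finset.univ : Finset P)
  have hx0 : ∀ v, 0 < x v := by
    intro v
    refine lt_of_le_of_ne (chainHull_nonneg hx v) fun h0 => ?_
    rw [Finset.prod_eq_zero (Finset.mem_univ v) h0.symm] at h1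
    norm_num at h1
  have hprod : 0 < ∏ v, x v := Finset.prod_pos fun v _ => hx0 v
  have hN : ((linExtLists (Finset.univ : Finset P)).ncard : ℝ) ≤ numLinearExtensions P := by
    exact_mod_cast ncard_linExtLists_univ_le
  have hle : ((linExtLists (Finset.univ : Finset P)).ncard : ℝ) ^ 2 * ∏ v, x v
      ≤ (numLinearExtensions P : ℝ) ^ 2 * ∏ v, x v := by gcongr
  have hNpos : (numLinearExtensions P : ℝ) ≠ 0 := by
    exact_mod_cast numLinearExtensions_pos.ne'
  have hlog : Real.logb 2 ((numLinearExtensions P : ℝ) ^ 2 * ∏ v, x v)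
      = 2 * Real.logb 2 (numLinearExtensions P : ℝ) + ∑ v, Real.logb 2 (x v) := by
    rw [Real.logb_mul (pow_ne_zero 2 hNpos) hprod.ne', Real.logb_pow,
      Real.logb_prod _ _ fun v _ => (hx0 v).ne']
    norm_num
  have hH := card_mul_graphEntropy_le (chainHull_subset_stab _ hx) hx0
  refine ⟨?_, fun hch => ?_⟩
  · have := Real.logb_nonneg (b := 2) (by norm_num) (h1.trans hle)
    linarith
  · have := Real.logb_pos (b := 2) (by norm_num) ((h2 hch).trans_le hle)
    linarith

end Main

theorem mainTheorem2 (P : Type*) [PartialOrder P] [Fintype P]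
    [DecidableRel (incompGraph P).Adj] (hP : posetWidth P = 2) :
    ((Fintype.card P : ℝ) * graphEntropy (incompGraph P)
        = 2 * Real.logb 2 (numLinearExtensions P : ℝ) ↔
      (incompGraph P).maxDegree = 1) ∧
    ((incompGraph P).maxDegree = 1 ↔ IsOrdinalSumOfSmallAntichains P) := by
  classical
  obtain ⟨a, b, hab⟩ := exists_incompRel_of_posetWidth hP
  have : Nonempty P := ⟨a⟩
  have hdeg : 1 ≤ (incompGraph P).maxDegree := by
    refine le_trans ?_ ((incompGraph P).degree_le_maxDegree a)
    rw [Nat.one_le_iff_ne_zero, ← Nat.pos_iff_ne_zero, SimpleGraph.degree_pos_iff_exists_adj]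
    exact ⟨b, hab⟩
  obtain ⟨hle, hlt⟩ := card_mul_graphEntropy_le_two_mul_logb hP.le
  have hcherry := hasCherry_iff_two_le_maxDegree (P := P)
  refine ⟨⟨fun h => ?_, fun h => ?_⟩, fun h => ?_, fun h => ?_⟩
  · by_contra hne
    exact (hlt (hcherry.2 (by omega))).ne h
  -- The sandwich is `2 log₂ e(P) ≤ 2|E| ≤ |P| * H ≤ 2 log₂ e(P)`.
  · refine le_antisymm hle (le_trans ?_ (two_mul_card_edges_le h.le))
    gcongr
    have h0 : 0 < numLinearExtensions P := numLinearExtensions_pos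
    have h1 : (numLinearExtensions P : ℝ) ≤ 2 ^ ((incompGraph P).edgeFinset.card : ℝ) := by
      rw [Real.rpow_natCast]
      exact_mod_cast numLinearExtensions_le_two_pow
    rw [Real.logb_le_iff_le_rpow (by norm_num) (by exact_mod_cast h0)]
    exact h1
  · obtain ⟨k, A, h1, h2, h3, -, h5⟩ := exists_ordinalSum_of_not_hasCherry (Finset.univ : Finset P)
      (fun h' => by have := hcherry.1 h'; omega)
    exact ⟨k, A, h1, h2, fun x => h3 x (Finset.mem_univ x), h5⟩
  · have := mt hcherry.2 (not_hasCherry_of_isOrdinalSum h)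
    omega
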